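/- Let $m_1\ge 3$ and $m_2\ge 0$ be integers, and put $a_{2n-1}=3^{n-1}-1$ and $a_{2n}=2\cdot 3^{n-1}-1$ for $n\ge 1$. A polygon $(v_1,\dots,v_p)$ is given by the cyclic sequence of its vertices; its sides are the pairs $\{v_i,v_{i+1}\}$ (indices mod $p$), and the edges of a collection of polygons are the sides of its members. (i) Let $N=2(3^{m_1-1}+2m_2-1)$. Let $\mathcal K$ be the collection of the $(2m_1-1)$-gons with vertices in $\mathbb Z/N$, $$F_j=(j+a_1,\dots,j+a_{2m_1-3},\ j+a_{2m_1-2}+m_2,\ j+a_{2m_1-1}+2m_2),\qquad j\in\mathbb Z/N .$$ (ii) Let $N'=3^{m_1}+2m_2-1$. Let $\mathcal K'$ be the collection of the $2m_1$-gons with vertices in $\mathbb Z/N'$, $$F'_j=(j+a_1,\dots,j+a_{2m_1-1},\ j+a_{2m_1}+m_2),\qquad j\in\mathbb Z/N' .$$ Then $\mathcal K$ and $\mathcal K'$ are equivelar maps on surfaces of types $[(2m_1-1)^{2m_1-1}]$ and $[(2m_1)^{2m_1}]$ respectively (the type $[p^q]$ means that all faces are $p$-gons and that the faces at each vertex form a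 cycle of length $q$), and the homological quantum code of each of them has minimum distance $d_{\min}=4$. Here the homological quantum code of a map with vertex-edge incidence matrix $H_X$ and face-edge incidence matrix $H_Z$ over $\mathbb F_2$ (which satisfy $H_XH_Z^{T}=0$) is the stabilizer code with check matrix $\begin{bmatrix}H_X&0\\0&H_Z\end{bmatrix}$. With $\mathcal C_X=\ker H_X$, $\mathcal C_Z=\ker H_Z$, with $\mathcal C^{\perp}$ the dual code of $\mathcal C$ and $\mathrm{wt}$ the Hamming weight, its minimum distance is $$d_{\min}=\min\{\mathrm{wt}(x): x\in(\mathcal C_Z\setminus\mathcal C_X^{\perp})\cup(\mathcal C_X\setminus\mathcal C_Z^{\perp})\}.$$ -/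

import Mathlib

noncomputable section

/-- A finite system of `p`-gons: every face `f` is the cyclic sequence of its corners
`corner f 0, corner f 1, …, corner f (p - 1)`, the corner after `corner f k` being
`corner f (k + 1)`. -/
structure PolygonSystem (p : ℕ) (V F : Type) where
  corner : F → ZMod p → V

namespace PolygonSystem

variable {p : ℕ} {V F : Type} (K : PolygonSystem p V F)

/-- The sides of a face: the pairs of cyclically consecutive corners. -/
def sides (f : F) : Set (Sym2 V) :=
  Set.range fun k : ZMod p => s(K.corner f k, K.corner f (k + 1))

/-- The graph whose edges are the sides of the faces. -/
def graph : SimpleGraph V :=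
  SimpleGraph.fromEdgeSet {e | ∃ f, e ∈ K.sides f}

/-- The edges of the system. -/
def Edge : Type := {e : Sym2 V // e ∈ K.graph.edgeSet}

instance [Finite V] : Finite K.Edge :=
  inferInstanceAs (Finite {e : Sym2 V // e ∈ K.graph.edgeSet})

instance [Finite V] : Fintype K.Edge := Fintype.ofFinite _

/-- The polygons glued along their common sides form a map on a surface (connected, closed)
which is equivelar of type `[p ^ q]`: the boundary of each face is a `p`-cycle of a connected
finite simple graph, each edge lies on exactly two faces, and the faces at each vertex form a
cycle of length `q`, in which consecutive faces share an edge at that vertex. -/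
structure IsEquivelarMap (q : ℕ) : Prop where
  finite_vertices : Finite V
  finite_faces : Finite F
  three_le_p : 3 ≤ p
  three_le_q : 3 ≤ q
  corner_injective : ∀ f, Function.Injective (K.corner f)
  connected : K.graph.Connected
  two_faces : ∀ e ∈ K.graph.edgeSet, {f | e ∈ K.sides f}.ncard = 2
  face_cycle : ∀ v : V, ∃ c : ZMod q → F, Function.Injective c ∧
    Set.range c = {f | v ∈ Set.range (K.corner f)} ∧
    ∀ k : ZMod q, ∃ e : Sym2 V, v ∈ e ∧ e ∈ K.sides (c k) ∧ e ∈ K.sides (c (k + 1))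

open Classical in
/-- The vertex-edge incidence matrix over `ℤ/2`, i.e. the matrix of `∂₁`. -/
def HX : Matrix V K.Edge (ZMod 2) := fun v e => if v ∈ e.1 then 1 else 0

open Classical in
/-- The face-edge incidence matrix over `ℤ/2`, i.e. the transpose of the matrix of `∂₂`. -/
def HZ : Matrix F K.Edge (ZMod 2) := fun f e => if e.1 ∈ K.sides f then 1 else 0

end PolygonSystem

/-- The binary linear code with parity-check matrix `H`. -/
def parityCode {r n : Type} [Fintype n] (H : Matrix r n (ZMod 2)) :
    Submodule (ZMod 2) (n → ZMod 2) :=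
  LinearMap.ker H.mulVecLin

/-- The dual of a binary linear code. -/
def dualCode {n : Type} [Fintype n] (C : Submodule (ZMod 2) (n → ZMod 2)) :
    Submodule (ZMod 2) (n → ZMod 2) where
  carrier := {y | ∀ x ∈ C, y ⬝ᵥ x = 0}
  zero_mem' := fun x _ => zero_dotProduct x
  add_mem' := fun {a b} ha hb x hx => by
    rw [add_dotProduct, ha x hx, hb x hx, add_zero]
  smul_mem' := fun c y hy x hx => by
    rw [smul_dotProduct, hy x hx, smul_zero]

/-- The matrices `HX` and `HZ` satisfy `HX * HZᵀ = 0`, so that they define a stabilizer code,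
and the minimum distance of this code is `d`. -/
structure IsQuantumCodeOfDistance {r s n : Type} [Fintype n]
    (HX : Matrix r n (ZMod 2)) (HZ : Matrix s n (ZMod 2)) (d : ℕ) : Prop where
  commute : HX * HZ.transpose = 0
  distance : IsLeast {w : ℕ | ∃ x : n → ZMod 2,
    ((x ∈ parityCode HZ ∧ x ∉ dualCode (parityCode HX)) ∨
      (x ∈ parityCode HX ∧ x ∉ dualCode (parityCode HZ))) ∧ hammingNorm x = w} d

/-- The sequence `a₁, a₂, …` with `a_{2n-1} = 3^(n-1) - 1` and `a_{2n} = 2 * 3^(n-1) - 1`. -/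
def duttaSeq (i : ℕ) : ℕ :=
  if Odd i then 3 ^ ((i - 1) / 2) - 1 else 2 * 3 ^ (i / 2 - 1) - 1

/-- The number of vertices of the map of type `[(2m₁-1)^(2m₁-1)]`. -/
def oddOrder (m₁ m₂ : ℕ) : ℕ := 2 * (3 ^ (m₁ - 1) + 2 * m₂ - 1)

/-- The number of vertices of the map of type `[(2m₁)^(2m₁)]`. -/
def evenOrder (m₁ m₂ : ℕ) : ℕ := 3 ^ m₁ + 2 * m₂ - 1

theorem three_le_three_pow {k : ℕ} (hk : 1 ≤ k) : 3 ≤ 3 ^ k := by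
  calc 3 = 3 ^ 1 := by norm_num
    _ ≤ 3 ^ k := Nat.pow_le_pow_right (by norm_num) hk

instance (m₁ m₂ : ℕ) [h : Fact (3 ≤ m₁)] : NeZero (oddOrder m₁ m₂) := ⟨by
  have h3 := h.out
  have := three_le_three_pow (k := m₁ - 1) (by omega)
  unfold oddOrder
  omega⟩

instance (m₁ m₂ : ℕ) [h : Fact (3 ≤ m₁)] : NeZero (evenOrder m₁ m₂) := ⟨by
  have h3 := h.out
  have := three_le_three_pow (k := m₁) (by omega)
  unfold evenOrder
  omega⟩

/-- The faces `F_j = (j + a₁, …, j + a_{2m₁-3}, j + a_{2m₁-2} + m₂, j + a_{2m₁-1} + 2 m₂)`,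
for `j` in `ℤ/N` with `N = 2 (3^(m₁-1) + 2 m₂ - 1)`. The position `k = 0, …, 2m₁-2` holds the
entry with index `k + 1`. -/
def duttaOdd (m₁ m₂ : ℕ) :
    PolygonSystem (2 * m₁ - 1) (ZMod (oddOrder m₁ m₂)) (ZMod (oddOrder m₁ m₂)) where
  corner j k := j + (duttaSeq (k.val + 1) : ZMod (oddOrder m₁ m₂)) +
    if k.val + 1 = 2 * m₁ - 1 then 2 * (m₂ : ZMod (oddOrder m₁ m₂))
    else if k.val + 1 = 2 * m₁ - 2 then (m₂ : ZMod (oddOrder m₁ m₂))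
    else 0

/-- The faces `F_j = (j + a₁, …, j + a_{2m₁-1}, j + a_{2m₁} + m₂)`, for `j` in `ℤ/N` with
`N = 3^m₁ + 2 m₂ - 1`. The position `k = 0, …, 2m₁-1` holds the entry with index `k + 1`. -/
def duttaEven (m₁ m₂ : ℕ) :
    PolygonSystem (2 * m₁) (ZMod (evenOrder m₁ m₂)) (ZMod (evenOrder m₁ m₂)) where
  corner j k := j + (duttaSeq (k.val + 1) : ZMod (evenOrder m₁ m₂)) +
    if k.val + 1 = 2 * m₁ then (m₂ : ZMod (evenOrder m₁ m₂)) else 0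

end

/-! In both families the differences of consecutive entries of a face, the closing one included, are
`s 0, s 0, s 1, s 1, …`, where `s i` is `3 ^ i` with corrections near the end, and they sum to the
modulus `N`. All faces are translates of one another, so everything is expressed by the offsets `c`
and the steps `t = (s 0, -s 0, s 1, -s 1, …)`. The face `v - c k` has at `v` the neighbours `v + t
(k - 1)` and `v + t k`, so the edge from `v` to `v + t k` lies exactly on the faces `v - c k` and `v
- c (k + 1)`. This gives the cycle of faces at `v`. For odd `p` the last step occurs once and the
cycle closes because that step is `N / 2`, its own negative.

Adjacent faces again differ by some `t k`, so the dual graph lies in the same circulant graph. Since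
`s` more than doubles at each index and no three of its terms sum to `N`, no three steps sum to `0`:
the graph is triangle-free. Nonzero vectors of `ker HX` and `ker HZ` then have weight at least `4`
(`four_le_hammingNorm_of_triangleFree`). Conversely, translates of the steps `1` and `d = s 1` give
a square and a dual square with exactly one common edge. Their product is `1`, so the square is not
in the dual of `ker HZ` (`isQuantumCodeOfDistance`). -/

/-! ### Weight bound from triangle-freeness. -/

/-- A nonzero vector in the kernel of the incidence matrix of a triangle-free simple graph has
weight at least `4`. -/
theorem four_le_hammingNorm_of_triangleFree {R n : Type} [Fintype n] {H : Matrix R n (ZMod 2)}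
    {ends : n → Sym2 R} {G : SimpleGraph R} (hinj : Function.Injective ends)
    (hG : ∀ e, ends e ∈ G.edgeSet)
    (htri : ∀ a b c, G.Adj a b → G.Adj b c → G.Adj c a → False)
    (h1 : ∀ v e, v ∈ ends e → H v e = 1) (h0 : ∀ v e, v ∉ ends e → H v e = 0)
    {x : n → ZMod 2} (hx : x ∈ parityCode H) (hx0 : x ≠ 0) : 4 ≤ hammingNorm x := by
  classical
  have hval : ∀ e, x e ≠ 0 → x e = 1 := fun e he => by
    generalize x e = z at he
    revert z; decide
  -- The kernel equation at `v` says that an even number of support edges meet at `v`, so none is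
  -- there alone.
  have key : ∀ v e, x e ≠ 0 → v ∈ ends e → ∃ e', e' ≠ e ∧ x e' ≠ 0 ∧ v ∈ ends e' := by
    intro v e he hv
    by_contra! hcon
    have hsum : ∑ e', H v e' * x e' = 0 := by
      have := congrFun (LinearMap.mem_ker.1 hx) v
      simpa [Matrix.mulVec, dotProduct] using this
    rw [Finset.sum_eq_single e] at hsum
    · rw [h1 v e hv, hval e he] at hsum
      simp at hsum
    · intro e' _ hne
      by_cases hxe : x e' = 0
      · simp [hxe]
      · simp [h0 v e' (hcon e' hne hxe)]
    · simp
  obtain ⟨e₀, he₀⟩ := Function.ne_iff.1 hx0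
  simp only [Pi.zero_apply] at he₀
  obtain ⟨a, b, hab⟩ : ∃ a b, ends e₀ = s(a, b) := by
    induction h : ends e₀ with | h a b => exact ⟨a, b, rfl⟩
  have hAab : G.Adj a b := by simpa [hab] using hG e₀
  obtain ⟨e₁, h10, hx1, ha1⟩ := key a e₀ he₀ (by simp [hab])
  obtain ⟨c, hc⟩ := ha1
  have hAac : G.Adj a c := by simpa [hc] using hG e₁
  have hcb : c ≠ b := by
    rintro rfl
    exact h10 (hinj (hc.trans hab.symm))
  obtain ⟨e₂, h20, hx2, hb2⟩ := key b e₀ he₀ (by simp [hab])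
  have h21 : e₂ ≠ e₁ := by
    rintro rfl
    rw [hc, Sym2.mem_iff] at hb2
    rcases hb2 with rfl | rfl
    · exact hAab.ne rfl
    · exact hcb rfl
  obtain ⟨e₃, h31, hx3, hc3⟩ := key c e₁ hx1 (by simp [hc])
  have h30 : e₃ ≠ e₀ := by
    rintro rfl
    rw [hab, Sym2.mem_iff] at hc3
    rcases hc3 with rfl | rfl
    · exact hAac.ne rfl
    · exact hcb rfl
  -- If `e₃ = e₂`, this edge joins `b` to `c` and closes a triangle.
  have h32 : e₃ ≠ e₂ := by
    rintro rfl
    have : ends e₃ = s(b, c) := ((Sym2.mem_and_mem_iff hcb.symm).1 ⟨hb2, hc3⟩)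
    have hA : G.Adj b c := by simpa [this] using hG e₃
    exact htri a b c hAab hA hAac.symm
  have hsub : ({e₀, e₁, e₂, e₃} : Finset n) ⊆ Finset.univ.filter fun e => x e ≠ 0 := by
    intro e he
    simp only [Finset.mem_insert, Finset.mem_singleton] at he
    rcases he with rfl | rfl | rfl | rfl <;> simp [*]
  have hcard : ({e₀, e₁, e₂, e₃} : Finset n).card = 4 := by
    rw [Finset.card_eq_of_equiv_fin]
    exact (Finset.equivFinOfCardEq (by
      rw [Finset.card_insert_of_notMem, Finset.card_insert_of_notMem,
        Finset.card_insert_of_notMem, Finset.card_singleton] <;>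
      simp [h10.symm, h20.symm, h30.symm, h21.symm, h31.symm, h32.symm]))
  rw [hammingNorm]
  exact hcard ▸ Finset.card_le_card hsub

/-! ### Circulant maps: edges, faces and vertex cycles. -/

/-- The polygons `(j + c 0, …, j + c (p - 1))`, for `j` in `ℤ/N`. -/
def circulantSystem {p N : ℕ} (c : ZMod p → ZMod N) :
    PolygonSystem p (ZMod N) (ZMod N) where
  corner j k := j + c k

/-- Conditions on the offsets `c` of a circulant polygon system under which the neighbours of
each vertex `v` are `v + t 0, …, v + t (p - 1)`, listed in cyclic order. -/
structure IsRotation {p N : ℕ} (c t : ZMod p → ZMod N) : Prop where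
  offset_injective : Function.Injective c
  step_injective : Function.Injective t
  step : ∀ k, (c (k + 1) - c k = t k ∧ c k - c (k - 1) = -t (k - 1)) ∨
    (c (k + 1) - c k = t (k - 1) ∧ c k - c (k - 1) = -t k)

namespace IsRotation

variable {p N : ℕ} {c t : ZMod p → ZMod N}

theorem ne_add_one (hp : 3 ≤ p) (k : ZMod p) : k ≠ k + 1 := by
  have : Fact (1 < p) := ⟨by omega⟩
  simp

theorem step_ne_zero (h : IsRotation c t) (hp : 3 ≤ p) (k : ZMod p) : t k ≠ 0 := by
  intro hk
  rcases h.step k with ⟨h1, -⟩ | ⟨-, h2⟩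
  · rw [hk, sub_eq_zero] at h1
    exact ne_add_one hp k (h.offset_injective h1).symm
  · rw [hk, neg_zero, sub_eq_zero] at h2
    have := h.offset_injective h2
    have h3 := ne_add_one hp (k - 1)
    rw [sub_add_cancel] at h3
    exact h3 this.symm

/-- The sides at a corner of a face. -/
theorem mem_sides_iff (h : IsRotation c t) (v : ZMod N) (k : ZMod p) (j : ZMod N) :
    s(v, v + t k) ∈ (circulantSystem c).sides j ↔ j = v - c k ∨ j = v - c (k + 1) := by
  constructor
  · rintro ⟨l, hl⟩
    simp only [circulantSystem, Sym2.eq_iff] at hl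
    -- The face traverses the side away from `v` or towards it. Injectivity of `t` then leaves one
    -- position for each alternative of `h.step`.
    rcases hl with ⟨h1, h2⟩ | ⟨h1, h2⟩
    · have hD : c (l + 1) - c l = t k := by linear_combination h2 - h1
      rcases h.step l with ⟨h3, -⟩ | ⟨h3, -⟩
      · obtain rfl := h.step_injective (h3.symm.trans hD)
        left; linear_combination h1
      · obtain rfl := h.step_injective (h3.symm.trans hD)
        right; rw [sub_add_cancel]; linear_combination h1
    · have hD : c (l + 1) - c l = -t k := by linear_combination h2 - h1
      have h4 := h.step (l + 1)
      rw [add_sub_cancel_right] at h4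
      rcases h4 with ⟨-, h3⟩ | ⟨-, h3⟩
      · obtain rfl := h.step_injective (neg_injective (h3.symm.trans hD))
        right; linear_combination h2
      · obtain rfl := h.step_injective (neg_injective (h3.symm.trans hD))
        left; linear_combination h2
  · rintro (rfl | rfl)
    · rcases h.step k with ⟨h1, -⟩ | ⟨-, h2⟩
      · refine ⟨k, Sym2.eq_iff.2 (Or.inl ⟨?_, ?_⟩)⟩ <;> simp only [circulantSystem]
        · ring
        · linear_combination h1
      · refine ⟨k - 1, Sym2.eq_iff.2 (Or.inr ⟨?_, ?_⟩)⟩ <;>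
          simp only [circulantSystem, sub_add_cancel]
        linear_combination -h2
    · have h4 := h.step (k + 1)
      rw [add_sub_cancel_right] at h4
      rcases h4 with ⟨-, h3⟩ | ⟨h3, -⟩
      · refine ⟨k, Sym2.eq_iff.2 (Or.inr ⟨?_, ?_⟩)⟩ <;> simp only [circulantSystem]
        · linear_combination -h3
        · ring
      · refine ⟨k + 1, Sym2.eq_iff.2 (Or.inl ⟨?_, ?_⟩)⟩ <;> simp only [circulantSystem]
        · ring
        · linear_combination h3

theorem exists_side (h : IsRotation c t) {v : ZMod N} {e : Sym2 (ZMod N)} (hv : v ∈ e)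
    {j : ZMod N} (he : e ∈ (circulantSystem c).sides j) : ∃ k, e = s(v, v + t k) := by
  obtain ⟨l, rfl⟩ := he
  simp only [circulantSystem, Sym2.mem_iff] at hv ⊢
  rcases hv with rfl | rfl
  · rcases h.step l with ⟨h3, -⟩ | ⟨h3, -⟩
    · exact ⟨l, by rw [← h3]; congr 1; ring_nf⟩
    · exact ⟨l - 1, by rw [← h3]; congr 1; ring_nf⟩
  · have h4 := h.step (l + 1)
    rw [add_sub_cancel_right] at h4
    rcases h4 with ⟨-, h3⟩ | ⟨-, h3⟩
    · refine ⟨l, Sym2.eq_iff.2 (Or.inr ⟨?_, rfl⟩)⟩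
      linear_combination -h3
    · refine ⟨l + 1, Sym2.eq_iff.2 (Or.inr ⟨?_, rfl⟩)⟩
      linear_combination -h3

theorem adj_iff (h : IsRotation c t) (hp : 3 ≤ p) (v w : ZMod N) :
    (circulantSystem c).graph.Adj v w ↔ ∃ k, w = v + t k := by
  simp only [PolygonSystem.graph, SimpleGraph.fromEdgeSet_adj, Set.mem_ofPred_eq]
  constructor
  · rintro ⟨⟨j, hj⟩, -⟩
    obtain ⟨k, hk⟩ := h.exists_side (Sym2.mem_mk_left v w) hj
    exact ⟨k, Sym2.congr_right.1 hk⟩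
  · rintro ⟨k, rfl⟩
    refine ⟨⟨v - c k, (h.mem_sides_iff v k _).2 (Or.inl rfl)⟩, ?_⟩
    have := h.step_ne_zero hp k
    simpa using this

theorem exists_eq_of_mem_edgeSet (h : IsRotation c t) (hp : 3 ≤ p) {v : ZMod N}
    {e : Sym2 (ZMod N)} (he : e ∈ (circulantSystem c).graph.edgeSet) (hv : v ∈ e) :
    ∃ k, e = s(v, v + t k) := by
  obtain ⟨w, rfl⟩ := hv
  obtain ⟨k, rfl⟩ := (h.adj_iff hp v w).1 he
  exact ⟨k, rfl⟩

/-- The edge joining `v` to `v + t k`. -/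
def edge (h : IsRotation c t) (hp : 3 ≤ p) (v : ZMod N) (k : ZMod p) :
    (circulantSystem c).Edge :=
  ⟨s(v, v + t k), (h.adj_iff hp v _).2 ⟨k, rfl⟩⟩

theorem exists_eq_edge (h : IsRotation c t) (hp : 3 ≤ p) (e : (circulantSystem c).Edge)
    {v : ZMod N} (hv : v ∈ e.1) : ∃ k, e = h.edge hp v k := by
  obtain ⟨k, hk⟩ := h.exists_eq_of_mem_edgeSet hp e.2 hv
  exact ⟨k, Subtype.ext hk⟩

theorem edge_injective (h : IsRotation c t) (hp : 3 ≤ p) (v : ZMod N) :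
    Function.Injective (h.edge hp v) := by
  intro k l hkl
  have := Sym2.congr_right.1 (congrArg Subtype.val hkl)
  exact h.step_injective (add_left_cancel this)

theorem exists_mem_edge (e : (circulantSystem c).Edge) : ∃ v, v ∈ e.1 := by
  obtain ⟨e, he⟩ := e
  induction e with | h a b => exact ⟨a, Sym2.mem_mk_left a b⟩

theorem isEquivelarMap [NeZero N] (h : IsRotation c t) (hp : 3 ≤ p) (h1 : ∃ k, t k = 1) :
    (circulantSystem c).IsEquivelarMap p where
  finite_vertices := inferInstance
  finite_faces := inferInstance
  three_le_p := hp
  three_le_q := hp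
  corner_injective f k l hkl := h.offset_injective (add_left_cancel hkl)
  connected := by
    -- The step `1` joins `n` to `n + 1`, hence `0` to everything.
    obtain ⟨k, hk⟩ := h1
    have hr : ∀ n : ℕ, (circulantSystem c).graph.Reachable 0 (n : ZMod N) := by
      intro n
      induction n with
      | zero => simp
      | succ n ih =>
        refine ih.trans (SimpleGraph.Adj.reachable ((h.adj_iff hp _ _).2 ⟨k, ?_⟩))
        rw [hk]; push_cast; rfl
    have hr' : ∀ v, (circulantSystem c).graph.Reachable 0 v := fun v => by
      simpa using hr v.val
    exact ⟨fun v w => (hr' v).symm.trans (hr' w)⟩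
  two_faces e he := by
    induction e with | h a b =>
    obtain ⟨k, rfl⟩ := (h.adj_iff hp a b).1 he
    have : {f | s(a, a + t k) ∈ (circulantSystem c).sides f} = {a - c k, a - c (k + 1)} := by
      ext j
      simp [h.mem_sides_iff]
    rw [this, Set.ncard_pair]
    intro hc
    exact ne_add_one hp k (h.offset_injective (sub_right_injective hc))
  face_cycle v := by
    refine ⟨fun k => v - c k, fun k l hkl => h.offset_injective (sub_right_injective hkl), ?_,
      fun k => ⟨s(v, v + t k), Sym2.mem_mk_left _ _, ?_, ?_⟩⟩
    · ext j
      simp only [Set.mem_range, Set.mem_ofPred_eq, circulantSystem]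
      exact exists_congr fun k => by rw [sub_eq_iff_eq_add, eq_comm]
    · exact (h.mem_sides_iff _ _ _).2 (Or.inl rfl)
    · exact (h.mem_sides_iff _ _ _).2 (Or.inr rfl)

/-! ### Incidence matrices and the lower bound on the weight. -/

theorem HX_edge (h : IsRotation c t) (hp : 3 ≤ p) (w v : ZMod N) (k : ZMod p) :
    (circulantSystem c).HX w (h.edge hp v k) =
      (if w = v then 1 else 0) + if w = v + t k then 1 else 0 := by
  have := h.step_ne_zero hp k
  by_cases h1 : w = v
  · subst h1
    simp [PolygonSystem.HX, edge, this]
  · simp [PolygonSystem.HX, edge, h1]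

theorem HZ_edge (h : IsRotation c t) (hp : 3 ≤ p) (j v : ZMod N) (k : ZMod p) :
    (circulantSystem c).HZ j (h.edge hp v k) =
      (if j = v - c k then 1 else 0) + if j = v - c (k + 1) then 1 else 0 := by
  have : c k ≠ c (k + 1) := fun hc => ne_add_one hp k (h.offset_injective hc)
  by_cases h1 : j = v - c k
  · subst h1
    simp [PolygonSystem.HZ, edge, this, h.mem_sides_iff]
  · simp [PolygonSystem.HZ, edge, h1, h.mem_sides_iff]

/-- The edges at `v`, indexed by `k`, lie on the faces `v - c k` and `v - c (k + 1)`. Shifting `k`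
by one makes the two contributions equal, and they cancel modulo `2`. -/
theorem commute [NeZero p] [NeZero N] (h : IsRotation c t) (hp : 3 ≤ p) :
    (circulantSystem c).HX * (circulantSystem c).HZ.transpose = 0 := by
  ext v j
  rw [Matrix.mul_apply, Matrix.zero_apply]
  have h1 : ∑ e, (circulantSystem c).HX v e * (circulantSystem c).HZ.transpose e j =
      ∑ k, (circulantSystem c).HZ j (h.edge hp v k) := by
    symm
    refine Finset.sum_of_injOn (h.edge hp v) (h.edge_injective hp v).injOn (by simp) ?_ ?_
    · intro e _ he
      have : v ∉ e.1 := fun hv => he <| by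
        obtain ⟨k, rfl⟩ := h.exists_eq_edge hp e hv
        simp
      simp [PolygonSystem.HX, this]
    · intro k _
      have := h.step_ne_zero hp k
      simp [h.HX_edge hp, this, Matrix.transpose_apply]
  rw [h1]
  simp only [h.HZ_edge hp, Finset.sum_add_distrib]
  have h2 := Equiv.sum_comp (Equiv.addRight (1 : ZMod p)) fun k => if j = v - c k then (1 : ZMod 2) else 0
  simp only [Equiv.coe_addRight] at h2
  exact (congrArg₂ (· + ·) rfl h2).trans (CharTwo.add_self_eq_zero _)

theorem triangleFree (h : IsRotation c t) (hp : 3 ≤ p)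
    (htri : ∀ i j k, t i + t j + t k ≠ 0) (u v w : ZMod N)
    (h1 : (circulantSystem c).graph.Adj u v) (h2 : (circulantSystem c).graph.Adj v w)
    (h3 : (circulantSystem c).graph.Adj w u) : False := by
  obtain ⟨i, rfl⟩ := (h.adj_iff hp _ _).1 h1
  obtain ⟨j, rfl⟩ := (h.adj_iff hp _ _).1 h2
  obtain ⟨k, hk⟩ := (h.adj_iff hp _ _).1 h3
  exact htri i j k (by linear_combination -hk)

theorem four_le_of_mem_HX [NeZero N] (h : IsRotation c t) (hp : 3 ≤ p)
    (htri : ∀ i j k, t i + t j + t k ≠ 0) {x : (circulantSystem c).Edge → ZMod 2}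
    (hx : x ∈ parityCode (circulantSystem c).HX) (hx0 : x ≠ 0) : 4 ≤ hammingNorm x := by
  refine four_le_hammingNorm_of_triangleFree (n := (circulantSystem c).Edge)
    (ends := Subtype.val) Subtype.val_injective (fun e => e.2) (h.triangleFree hp htri) ?_ ?_ hx hx0
  · intro v e hv
    simp [PolygonSystem.HX, hv]
  · intro v e hv
    simp [PolygonSystem.HX, hv]

/-- The two faces at an edge, which are adjacent in the graph of the system itself. -/
theorem exists_faces (h : IsRotation c t) (hp : 3 ≤ p) (e : (circulantSystem c).Edge) :
    ∃ f ∈ (circulantSystem c).graph.edgeSet,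
      ∀ j, j ∈ f ↔ e.1 ∈ (circulantSystem c).sides j := by
  obtain ⟨v, hv⟩ := exists_mem_edge e
  obtain ⟨k, rfl⟩ := h.exists_eq_edge hp e hv
  refine ⟨s(v - c (k + 1), v - c k), ?_, fun j => ?_⟩
  · rw [SimpleGraph.mem_edgeSet, h.adj_iff hp]
    rcases h.step k with ⟨h1, -⟩ | ⟨h1, -⟩
    · exact ⟨k, by linear_combination h1⟩
    · exact ⟨k - 1, by linear_combination h1⟩
  · rw [edge, h.mem_sides_iff, Sym2.mem_iff, or_comm]

/-- The face on the other side of the `k`-th side of the face `j` is `j - t k`. -/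
theorem side_mem_sides (h : IsRotation c t) (j l : ZMod N) (k : ZMod p) :
    s(j + c k, j + c (k + 1)) ∈ (circulantSystem c).sides l ↔ l = j ∨ l = j - t k := by
  rcases h.step k with ⟨h1, -⟩ | ⟨h1, h2⟩
  · have : j + c (k + 1) = j + c k + t k := by linear_combination h1
    rw [this, h.mem_sides_iff]
    have e1 : j + c k - c k = j := by ring
    have e2 : j + c k - c (k + 1) = j - t k := by linear_combination -h1
    rw [e1, e2]
  · have : j + c (k + 1) = j + c k + t (k - 1) := by linear_combination h1
    rw [this, h.mem_sides_iff, sub_add_cancel]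
    have e1 : j + c k - c k = j := by ring
    have e2 : j + c k - c (k - 1) = j - t k := by linear_combination h2
    rw [e1, e2, or_comm]

/-- On a common face `j`, the face across side `l` is `j - t l`. Distinct sides thus lead to
distinct neighbouring faces, and the dual graph has no multiple edges. -/
theorem edge_ext_faces (h : IsRotation c t) (hp : 3 ≤ p) {e e' : (circulantSystem c).Edge}
    (hee : ∀ j, e.1 ∈ (circulantSystem c).sides j ↔ e'.1 ∈ (circulantSystem c).sides j) :
    e = e' := by
  obtain ⟨v, hv⟩ := exists_mem_edge e
  obtain ⟨k, rfl⟩ := h.exists_eq_edge hp e hv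
  have hj : (h.edge hp v k).1 ∈ (circulantSystem c).sides (v - c k) :=
    (h.mem_sides_iff _ _ _).2 (Or.inl rfl)
  have hj' := (hee _).1 hj
  generalize v - c k = j at hj hj'
  generalize h.edge hp v k = e at *
  obtain ⟨l, hl⟩ := hj
  obtain ⟨m, hm⟩ := hj'
  simp only [circulantSystem] at hl hm
  have h1 := hee (j - t l)
  rw [← hl, ← hm] at h1
  have h2 := h1.1 ((h.side_mem_sides j _ l).2 (Or.inr rfl))
  rcases (h.side_mem_sides j _ m).1 h2 with h3 | h3
  · exact absurd (sub_eq_self.1 h3) (h.step_ne_zero hp l)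
  · obtain rfl := h.step_injective (sub_right_injective h3)
    exact Subtype.ext (hl.symm.trans hm)

/-- The bound for triangle-free graphs is applied to the dual graph: an edge is sent to its pair of
faces, which is an edge of the same circulant graph. -/
theorem four_le_of_mem_HZ [NeZero N] (h : IsRotation c t) (hp : 3 ≤ p)
    (htri : ∀ i j k, t i + t j + t k ≠ 0) {x : (circulantSystem c).Edge → ZMod 2}
    (hx : x ∈ parityCode (circulantSystem c).HZ) (hx0 : x ≠ 0) : 4 ≤ hammingNorm x := by
  choose ends hends hmem using h.exists_faces hp
  refine four_le_hammingNorm_of_triangleFree (ends := ends) ?_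
    hends (h.triangleFree hp htri) ?_ ?_ hx hx0
  · intro e e' hee
    exact h.edge_ext_faces hp fun j => by rw [← hmem, ← hmem, hee]
  · intro j e hj
    simp [PolygonSystem.HZ, (hmem e j).1 hj]
  · intro j e hj
    simp [PolygonSystem.HZ, mt (hmem e j).2 hj]

/-! ### A codeword of weight four. -/

theorem mem_parityCode_of_sum {r n : Type} [Fintype n] [DecidableEq n]
    {H : Matrix r n (ZMod 2)} {a b c d : n} (hH : ∀ v, H v a + H v b + H v c + H v d = 0) :
    Pi.single a 1 + Pi.single b 1 + Pi.single c 1 + Pi.single d 1 ∈ parityCode H := by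
  rw [parityCode, LinearMap.mem_ker]
  ext v
  simp [Matrix.mulVec_add, hH v]

theorem hammingNorm_sum_le {n : Type} [Fintype n] [DecidableEq n] (a b c d : n) :
    hammingNorm (Pi.single a 1 + Pi.single b 1 + Pi.single c 1 + Pi.single d 1 :
      n → ZMod 2) ≤ 4 := by
  refine le_trans (Finset.card_le_card (t := {a, b, c, d}) fun e he => ?_) Finset.card_le_four
  by_contra hcon
  simp only [Finset.mem_insert, Finset.mem_singleton, not_or] at hcon
  simp [hcon] at he

/-- The quantum code of a triangle-free circulant map in which the first three steps around a
vertex are `1`, `-1` and `d` has minimum distance `4`. -/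
theorem isQuantumCodeOfDistance [NeZero p] [NeZero N] (h : IsRotation c t) (hp : 3 ≤ p)
    (htri : ∀ i j k, t i + t j + t k ≠ 0) {k₀ k₁ : ZMod p} {d : ℕ} (hd : 2 ≤ d)
    (hdN : 2 * d + 2 < N) (ht0 : t k₀ = 1) (ht1 : t k₁ = d) (hc0 : c k₀ = 0)
    (hc0' : c (k₀ + 1) = 1) (hc1 : c k₁ = 2) (hc1' : c (k₁ + 1) = 2 + d) :
    IsQuantumCodeOfDistance (circulantSystem c).HX (circulantSystem c).HZ 4 := by
  classical
  have hne : ∀ a b : ℕ, a < N → b < N → a ≠ b → (a : ZMod N) ≠ (b : ZMod N) := by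
    intro a b ha hb hab he
    rw [ZMod.natCast_eq_natCast_iff', Nat.mod_eq_of_lt ha, Nat.mod_eq_of_lt hb] at he
    exact hab he
  -- The square `0, 1, 1 + d, d`.
  let x : (circulantSystem c).Edge → ZMod 2 := Pi.single (h.edge hp 0 k₀) 1 +
    Pi.single (h.edge hp 1 k₁) 1 + Pi.single (h.edge hp d k₀) 1 + Pi.single (h.edge hp 0 k₁) 1
  -- The edges crossed by the dual square of faces `d, d - 1, 2d - 1, 2d`. Its only edge in common
  -- with `x` is the one joining `d` to `d + 1`.
  let y : (circulantSystem c).Edge → ZMod 2 := Pi.single (h.edge hp d k₀) 1 +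
    Pi.single (h.edge hp (2 * d) k₀) 1 + Pi.single (h.edge hp (2 * d + 1) k₁) 1 +
    Pi.single (h.edge hp (2 * d + 2) k₁) 1
  have hx : x ∈ parityCode (circulantSystem c).HX := by
    refine mem_parityCode_of_sum fun v => ?_
    simp only [h.HX_edge hp, ht0, ht1, zero_add]
    rw [add_comm (1 : ZMod N) d]
    -- Each vertex of the square is counted twice. With the indicators abstracted, this is a finite
    -- identity in `ZMod 2`.
    generalize (if v = (0 : ZMod N) then (1 : ZMod 2) else 0) = z₁
    generalize (if v = (1 : ZMod N) then (1 : ZMod 2) else 0) = z₂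
    generalize (if v = (d : ZMod N) then (1 : ZMod 2) else 0) = z₃
    generalize (if v = (d + 1 : ZMod N) then (1 : ZMod 2) else 0) = z₄
    revert z₁ z₂ z₃ z₄
    decide
  have hy : y ∈ parityCode (circulantSystem c).HZ := by
    refine mem_parityCode_of_sum fun v => ?_
    simp only [h.HZ_edge hp, hc0, hc0', hc1, hc1', sub_zero]
    rw [show (2 * d + 1 - 2 : ZMod N) = 2 * d - 1 by ring,
      show (2 * d + 1 - (2 + d) : ZMod N) = d - 1 by ring,
      show (2 * d + 2 - 2 : ZMod N) = 2 * d by ring,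
      show (2 * d + 2 - (2 + d) : ZMod N) = d by ring]
    generalize (if v = (d : ZMod N) then (1 : ZMod 2) else 0) = z₁
    generalize (if v = (d - 1 : ZMod N) then (1 : ZMod 2) else 0) = z₂
    generalize (if v = (2 * d : ZMod N) then (1 : ZMod 2) else 0) = z₃
    generalize (if v = (2 * d - 1 : ZMod N) then (1 : ZMod 2) else 0) = z₄
    revert z₁ z₂ z₃ z₄
    decide
  have hxy : x ⬝ᵥ y = 1 := by
    -- Two edges differ once a chosen endpoint of one avoids both ends of the other. Choosing well
    -- keeps every comparison within `0, …, 2d + 2`, below `N`.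
    have hq : ∀ v k w l, v ≠ w → v ≠ w + t l → h.edge hp v k ≠ h.edge hp w l := by
      intro v k w l h1 h2 he
      have : v ∈ (h.edge hp w l).1 := by rw [← he]; exact Sym2.mem_mk_left _ _
      rcases Sym2.mem_iff.1 this with h3 | h3
      · exact h1 h3
      · exact h2 h3
    have hy0 : y (h.edge hp 0 k₀) = 0 := by
      have e1 : h.edge hp 0 k₀ ≠ h.edge hp d k₀ := by
        refine hq _ _ _ _ ?_ ?_
        · exact_mod_cast hne 0 d (by omega) (by omega) (by omega)
        · rw [ht0]
          exact_mod_cast hne 0 (d + 1) (by omega) (by omega) (by omega)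
      have e2 : h.edge hp (2 * d) k₀ ≠ h.edge hp 0 k₀ := by
        refine hq _ _ _ _ ?_ ?_
        · exact_mod_cast hne (2 * d) 0 (by omega) (by omega) (by omega)
        · rw [ht0, zero_add]
          exact_mod_cast hne (2 * d) 1 (by omega) (by omega) (by omega)
      have e3 : h.edge hp (2 * d + 1) k₁ ≠ h.edge hp 0 k₀ := by
        refine hq _ _ _ _ ?_ ?_
        · exact_mod_cast hne (2 * d + 1) 0 (by omega) (by omega) (by omega)
        · rw [ht0, zero_add]
          exact_mod_cast hne (2 * d + 1) 1 (by omega) (by omega) (by omega)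
      have e4 : h.edge hp (2 * d + 2) k₁ ≠ h.edge hp 0 k₀ := by
        refine hq _ _ _ _ ?_ ?_
        · exact_mod_cast hne (2 * d + 2) 0 (by omega) (by omega) (by omega)
        · rw [ht0, zero_add]
          exact_mod_cast hne (2 * d + 2) 1 (by omega) (by omega) (by omega)
      simp [y, e1, e2.symm, e3.symm, e4.symm]
    have hy1 : y (h.edge hp 1 k₁) = 0 := by
      have e1 : h.edge hp d k₀ ≠ h.edge hp 1 k₁ := by
        refine hq _ _ _ _ ?_ ?_
        · exact_mod_cast hne d 1 (by omega) (by omega) (by omega)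
        · rw [ht1]
          exact_mod_cast hne d (1 + d) (by omega) (by omega) (by omega)
      have e2 : h.edge hp (2 * d) k₀ ≠ h.edge hp 1 k₁ := by
        refine hq _ _ _ _ ?_ ?_
        · exact_mod_cast hne (2 * d) 1 (by omega) (by omega) (by omega)
        · rw [ht1]
          exact_mod_cast hne (2 * d) (1 + d) (by omega) (by omega) (by omega)
      have e3 : h.edge hp (2 * d + 1) k₁ ≠ h.edge hp 1 k₁ := by
        refine hq _ _ _ _ ?_ ?_
        · exact_mod_cast hne (2 * d + 1) 1 (by omega) (by omega) (by omega)
        · rw [ht1]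
          exact_mod_cast hne (2 * d + 1) (1 + d) (by omega) (by omega) (by omega)
      have e4 : h.edge hp (2 * d + 2) k₁ ≠ h.edge hp 1 k₁ := by
        refine hq _ _ _ _ ?_ ?_
        · exact_mod_cast hne (2 * d + 2) 1 (by omega) (by omega) (by omega)
        · rw [ht1]
          exact_mod_cast hne (2 * d + 2) (1 + d) (by omega) (by omega) (by omega)
      simp [y, e1.symm, e2.symm, e3.symm, e4.symm]
    have hy2 : y (h.edge hp d k₀) = 1 := by
      have e2 : h.edge hp (2 * d) k₀ ≠ h.edge hp d k₀ := by
        refine hq _ _ _ _ ?_ ?_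
        · exact_mod_cast hne (2 * d) d (by omega) (by omega) (by omega)
        · rw [ht0]
          exact_mod_cast hne (2 * d) (d + 1) (by omega) (by omega) (by omega)
      have e3 : h.edge hp (2 * d + 1) k₁ ≠ h.edge hp d k₀ := by
        refine hq _ _ _ _ ?_ ?_
        · exact_mod_cast hne (2 * d + 1) d (by omega) (by omega) (by omega)
        · rw [ht0]
          exact_mod_cast hne (2 * d + 1) (d + 1) (by omega) (by omega) (by omega)
      have e4 : h.edge hp (2 * d + 2) k₁ ≠ h.edge hp d k₀ := by
        refine hq _ _ _ _ ?_ ?_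
        · exact_mod_cast hne (2 * d + 2) d (by omega) (by omega) (by omega)
        · rw [ht0]
          exact_mod_cast hne (2 * d + 2) (d + 1) (by omega) (by omega) (by omega)
      simp [y, e2.symm, e3.symm, e4.symm]
    have hy3 : y (h.edge hp 0 k₁) = 0 := by
      have e1 : h.edge hp 0 k₁ ≠ h.edge hp d k₀ := by
        refine hq _ _ _ _ ?_ ?_
        · exact_mod_cast hne 0 d (by omega) (by omega) (by omega)
        · rw [ht0]
          exact_mod_cast hne 0 (d + 1) (by omega) (by omega) (by omega)
      have e2 : h.edge hp (2 * d) k₀ ≠ h.edge hp 0 k₁ := by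
        refine hq _ _ _ _ ?_ ?_
        · exact_mod_cast hne (2 * d) 0 (by omega) (by omega) (by omega)
        · rw [ht1, zero_add]
          exact_mod_cast hne (2 * d) d (by omega) (by omega) (by omega)
      have e3 : h.edge hp (2 * d + 1) k₁ ≠ h.edge hp 0 k₁ := by
        refine hq _ _ _ _ ?_ ?_
        · exact_mod_cast hne (2 * d + 1) 0 (by omega) (by omega) (by omega)
        · rw [ht1, zero_add]
          exact_mod_cast hne (2 * d + 1) d (by omega) (by omega) (by omega)
      have e4 : h.edge hp (2 * d + 2) k₁ ≠ h.edge hp 0 k₁ := by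
        refine hq _ _ _ _ ?_ ?_
        · exact_mod_cast hne (2 * d + 2) 0 (by omega) (by omega) (by omega)
        · rw [ht1, zero_add]
          exact_mod_cast hne (2 * d + 2) d (by omega) (by omega) (by omega)
      simp [y, e1, e2.symm, e3.symm, e4.symm]
    have hxe : x ⬝ᵥ y = y (h.edge hp 0 k₀) + y (h.edge hp 1 k₁) + y (h.edge hp d k₀) +
        y (h.edge hp 0 k₁) := by
      simp [x, add_dotProduct]
    rw [hxe, hy0, hy1, hy2, hy3]
    decide
  have hx0 : x ≠ 0 := by
    intro h0
    rw [h0, zero_dotProduct] at hxy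
    exact zero_ne_one hxy
  refine ⟨h.commute hp, ⟨x, Or.inr ⟨hx, fun hd => ?_⟩, ?_⟩, ?_⟩
  · exact one_ne_zero (hxy.symm.trans (hd y hy))
  · exact le_antisymm (hammingNorm_sum_le _ _ _ _) (h.four_le_of_mem_HX hp htri hx hx0)
  -- A dual code contains `0`, so `x` is nonzero, which is all that the weight bounds need.
  · rintro w ⟨x, hx | hx, rfl⟩
    · exact h.four_le_of_mem_HZ hp htri hx.1
        fun h0 => hx.2 (h0 ▸ Submodule.zero_mem _)
    · exact h.four_le_of_mem_HX hp htri hx.1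
        fun h0 => hx.2 (h0 ▸ Submodule.zero_mem _)

end IsRotation

/-! ### Sums of small residues. -/

namespace ZMod

theorem val_add_one_eq_or {p : ℕ} [NeZero p] (hp : 1 < p) (k : ZMod p) :
    (k.val + 1 < p ∧ (k + 1).val = k.val + 1) ∨ (k.val + 1 = p ∧ k + 1 = 0) := by
  have hlt := k.val_lt
  have : Fact (1 < p) := ⟨hp⟩
  rcases Nat.lt_or_ge (k.val + 1) p with h | h
  · exact Or.inl ⟨h, by rw [ZMod.val_add, ZMod.val_one, Nat.mod_eq_of_lt h]⟩
  · have h' : k.val + 1 = p := by omega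
    refine Or.inr ⟨h', ?_⟩
    rw [← ZMod.val_eq_zero, ZMod.val_add, ZMod.val_one, h', Nat.mod_self]

/-- Here `a + b ≤ N`, and reduction only matters when `a + b = N`, where the residue is `0` whereas
`0 < c < N`. -/
theorem natCast_add_ne {N a b c : ℕ} (hc : 0 < c) (ha' : 2 * a ≤ N) (hb' : 2 * b ≤ N)
    (hc' : 2 * c ≤ N) (h : a + b ≠ c) : (a + b : ZMod N) ≠ c := by
  intro he
  have he' : ((a + b : ℕ) : ZMod N) = c := by exact_mod_cast he
  rw [ZMod.natCast_eq_natCast_iff', Nat.mod_eq_of_lt (show c < N by omega)] at he'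
  rcases Nat.lt_or_ge (a + b) N with h1 | h1
  · rw [Nat.mod_eq_of_lt h1] at he'
    exact h he'
  · rw [show a + b = N by omega, Nat.mod_self] at he'
    omega

/-- The sum is positive and at most `3N / 2`, so `N` is the only multiple it could equal. -/
theorem natCast_add_add_ne_zero {N a b c : ℕ} (hc : 0 < c) (ha' : 2 * a ≤ N)
    (hb' : 2 * b ≤ N) (hc' : 2 * c ≤ N) (h : a + b + c ≠ N) : (a + b + c : ZMod N) ≠ 0 := by
  intro he
  have he' : ((a + b + c : ℕ) : ZMod N) = 0 := by exact_mod_cast he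
  rw [ZMod.natCast_eq_zero_iff] at he'
  obtain ⟨q, hq⟩ := he'
  have : q ≠ 0 := by rintro rfl; omega
  have : q ≠ 1 := by rintro rfl; omega
  have : N * 2 ≤ N * q := Nat.mul_le_mul_left _ (by omega)
  omega

end ZMod

/-! ### From integer step lengths to triangle-free circulant maps. -/

/-- Conditions on positive integers `s 0, s 1, …` for the lengths `s 0, s 0, s 1, s 1, …`,
`p` in number, to be the successive steps along the faces of a triangle-free circulant map
on `ℤ/N`. -/
structure IsStepSequence (p N : ℕ) (s : ℕ → ℕ) : Prop where
  three_le : 3 ≤ p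
  pos : ∀ i, 2 * i < p → 0 < s i
  growth : ∀ i j, i < j → 2 * j < p → 2 * s i < s j
  sum_eq : ∑ i ∈ Finset.range p, s (i / 2) = N
  two_mul_lt : ∀ i, 2 * i + 1 < p → 2 * s i < N
  two_mul_eq : ∀ i, 2 * i + 1 = p → 2 * s i = N
  sum_ne : ∀ i j k, 2 * i < p → 2 * j < p → 2 * k < p → s i + s j + s k ≠ N

namespace IsStepSequence

variable {p N : ℕ} {s : ℕ → ℕ}

theorem two_mul_le (h : IsStepSequence p N s) {i : ℕ} (hi : 2 * i < p) : 2 * s i ≤ N := by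
  rcases Nat.lt_or_ge (2 * i + 1) p with h1 | h1
  · exact (h.two_mul_lt i h1).le
  · exact (h.two_mul_eq i (by omega)).le

theorem eq_of_eq (h : IsStepSequence p N s) {i j : ℕ} (hi : 2 * i < p) (hj : 2 * j < p)
    (hij : s i = s j) : i = j := by
  have := h.pos i hi
  rcases lt_trichotomy i j with h1 | h1 | h1
  · have := h.growth i j h1 hj
    omega
  · exact h1
  · have := h.growth j i h1 hi
    omega

/-- If both indices are below `k`, each summand is less than half of `s k`. Otherwise one summand is
already at least `s k` and the other is positive. -/
theorem add_ne (h : IsStepSequence p N s) {i j k : ℕ} (hi : 2 * i < p) (hj : 2 * j < p)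
    (hk : 2 * k < p) : s i + s j ≠ s k := by
  have hi0 := h.pos i hi
  have hj0 := h.pos j hj
  have hmono : ∀ a, 2 * a < p → k ≤ a → s k ≤ s a := by
    intro a ha hka
    rcases hka.eq_or_lt with rfl | h1
    · rfl
    · have := h.growth k a h1 ha
      omega
  rcases Nat.lt_or_ge i k with h1 | h1
  · rcases Nat.lt_or_ge j k with h2 | h2
    · have := h.growth i k h1 hk
      have := h.growth j k h2 hk
      omega
    · have := hmono j hj h2
      omega
  · have := hmono i hi h1
    omega

/-- The offsets of the corners of a face with steps `s 0, s 0, s 1, s 1, …`. -/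
def offset (p N : ℕ) (s : ℕ → ℕ) (k : ZMod p) : ZMod N :=
  ((∑ i ∈ Finset.range k.val, s (i / 2) : ℕ) : ZMod N)

/-- The steps `s 0, -s 0, s 1, -s 1, …` to the neighbours of a vertex. -/
def rotation (p N : ℕ) (s : ℕ → ℕ) (k : ZMod p) : ZMod N :=
  if Even k.val then (s (k.val / 2) : ZMod N) else -(s (k.val / 2) : ZMod N)

theorem offset_add_one [NeZero p] (h : IsStepSequence p N s) (k : ZMod p) :
    offset p N s (k + 1) - offset p N s k = (s (k.val / 2) : ZMod N) := by
  have hp := h.three_le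
  rcases ZMod.val_add_one_eq_or (by omega) k with ⟨-, h1⟩ | ⟨h1, h2⟩
  · rw [offset, offset, h1, Finset.sum_range_succ]
    push_cast
    ring
  · have h3 := h.sum_eq
    rw [← h1, Finset.sum_range_succ] at h3
    have h4 := congrArg (Nat.cast : ℕ → ZMod N) h3
    rw [ZMod.natCast_self, Nat.cast_add] at h4
    rw [h2]
    simp only [offset, ZMod.val_zero, Finset.range_zero, Finset.sum_empty, Nat.cast_zero]
    linear_combination -h4

theorem offset_injective [NeZero p] (h : IsStepSequence p N s) :
    Function.Injective (offset p N s) := by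
  have hlt : ∀ a b, a < b → b ≤ p →
      ∑ i ∈ Finset.range a, s (i / 2) < ∑ i ∈ Finset.range b, s (i / 2) := by
    intro a b hab hb
    refine Finset.sum_lt_sum_of_subset (i := a) (Finset.range_mono hab.le)
      (by simpa using hab) (by simp) (h.pos _ (by omega)) (by simp)
  intro k l hkl
  have hk := k.val_lt
  have hl := l.val_lt
  have h1 := hlt _ _ hk le_rfl
  have h2 := hlt _ _ hl le_rfl
  rw [h.sum_eq] at h1 h2
  rw [offset, offset, ZMod.natCast_eq_natCast_iff', Nat.mod_eq_of_lt h1,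
    Nat.mod_eq_of_lt h2] at hkl
  refine ZMod.val_injective p ?_
  rcases lt_trichotomy k.val l.val with h3 | h3 | h3
  · exact absurd hkl (hlt _ _ h3 hl.le).ne
  · exact h3
  · exact absurd hkl (hlt _ _ h3 hk.le).ne'

/-- Equal signs reduce to injectivity of `s`. Opposite signs would make a sum of two terms divisible
by `N`. The negative term sits at an odd position, so it is strictly less than `N / 2`, and the sum
lies strictly between `0` and `N`. -/
theorem rotation_injective [NeZero p] (h : IsStepSequence p N s) :
    Function.Injective (rotation p N s) := by
  intro k l hkl
  have hk := k.val_lt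
  have hl := l.val_lt
  refine ZMod.val_injective p ?_
  generalize hk' : k.val = a at *
  generalize hl' : l.val = b at *
  simp only [rotation, hk', hl'] at hkl
  have ha := h.pos (a / 2) (by omega)
  have hb := h.pos (b / 2) (by omega)
  have ha2 := h.two_mul_le (i := a / 2) (by omega)
  have hb2 := h.two_mul_le (i := b / 2) (by omega)
  have heq : (s (a / 2) : ZMod N) = s (b / 2) → a / 2 = b / 2 := by
    intro he
    rw [ZMod.natCast_eq_natCast_iff', Nat.mod_eq_of_lt (by omega),
      Nat.mod_eq_of_lt (by omega)] at he
    exact h.eq_of_eq (by omega) (by omega) he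
  have hopp : (s (a / 2) : ZMod N) = -(s (b / 2)) → s (a / 2) + s (b / 2) < N → False := by
    intro he hlt
    have he' : ((s (a / 2) + s (b / 2) : ℕ) : ZMod N) = 0 := by
      push_cast
      linear_combination he
    rw [ZMod.natCast_eq_zero_iff] at he'
    have := Nat.le_of_dvd (by omega) he'
    omega
  split_ifs at hkl with he1 he2 he2
  · have := heq hkl
    rw [Nat.even_iff] at he1 he2
    omega
  · refine (hopp hkl ?_).elim
    have := h.two_mul_lt (b / 2) (by rw [Nat.even_iff] at he2; omega)
    omega
  · refine (hopp (by linear_combination -hkl) ?_).elim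
    have := h.two_mul_lt (a / 2) (by rw [Nat.even_iff] at he1; omega)
    omega
  · have := heq (neg_injective hkl)
    rw [Nat.even_iff] at he1 he2
    omega

theorem isRotation [NeZero p] (h : IsStepSequence p N s) :
    IsRotation (offset p N s) (rotation p N s) where
  offset_injective := h.offset_injective
  step_injective := h.rotation_injective
  step k := by
    obtain ⟨l, rfl⟩ : ∃ l, k = l + 1 := ⟨k - 1, by ring⟩
    have hp := h.three_le
    rw [add_sub_cancel_right, h.offset_add_one, h.offset_add_one]
    simp only [rotation]
    rcases ZMod.val_add_one_eq_or (by omega) l with ⟨-, h1⟩ | ⟨h1, h2⟩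
    · rw [h1]
      by_cases he : Even l.val
      · right
        have : (l.val + 1) / 2 = l.val / 2 := by rw [Nat.even_iff] at he; omega
        simp [he, this, Nat.even_add_one]
      · left
        simp [he, Nat.even_add_one]
    · rw [h2]
      left
      by_cases he : Even l.val
      -- Wrap-around for odd `p`: the last step is `N / 2`, so it equals its negative.
      · have h3 := h.two_mul_eq (l.val / 2) (by rw [Nat.even_iff] at he; omega)
        have h4 := congrArg (Nat.cast : ℕ → ZMod N) h3
        rw [ZMod.natCast_self] at h4
        push_cast at h4
        simp only [ZMod.val_zero, Even.zero, if_true, he, true_and]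
        linear_combination h4
      · simp [he]

/-- Up to a global sign, either all three signs agree and `sum_ne` applies, or one term would be the
sum of the other two, against `add_ne`. -/
theorem rotation_add_add_ne [NeZero p] (h : IsStepSequence p N s) (i j k : ZMod p) :
    rotation p N s i + rotation p N s j + rotation p N s k ≠ 0 := by
  have hi := i.val_lt
  have hj := j.val_lt
  have hk := k.val_lt
  simp only [rotation]
  have hi' : 2 * (i.val / 2) < p := by omega
  have hj' : 2 * (j.val / 2) < p := by omega
  have hk' : 2 * (k.val / 2) < p := by omega
  have hsub : ∀ a b c, 2 * a < p → 2 * b < p → 2 * c < p →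
      (s a + s b : ZMod N) ≠ s c := fun a b c ha hb hc =>
    ZMod.natCast_add_ne (h.pos c hc) (h.two_mul_le ha) (h.two_mul_le hb)
      (h.two_mul_le hc) (h.add_ne ha hb hc)
  have hadd : (s (i.val / 2) + s (j.val / 2) + s (k.val / 2) : ZMod N) ≠ 0 :=
    ZMod.natCast_add_add_ne_zero (h.pos _ hk') (h.two_mul_le hi') (h.two_mul_le hj')
      (h.two_mul_le hk') (h.sum_ne _ _ _ hi' hj' hk')
  have h1 := hsub _ _ _ hi' hj' hk'
  have h2 := hsub _ _ _ hi' hk' hj'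
  have h3 := hsub _ _ _ hj' hk' hi'
  intro he
  split_ifs at he
  · exact hadd he
  · exact h1 (by linear_combination he)
  · exact h2 (by linear_combination he)
  · exact h3 (by linear_combination -he)
  · exact h3 (by linear_combination he)
  · exact h2 (by linear_combination -he)
  · exact h1 (by linear_combination -he)
  · exact hadd (by linear_combination -he)

theorem equivelar_and_distance [NeZero p] [NeZero N] (h : IsStepSequence p N s) (hp : 5 ≤ p)
    (h0 : s 0 = 1) (h1 : 2 * s 1 + 2 < N) :
    (circulantSystem (offset p N s)).IsEquivelarMap p ∧
      IsQuantumCodeOfDistance (circulantSystem (offset p N s)).HX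
        (circulantSystem (offset p N s)).HZ 4 := by
  have h2 : ((2 : ℕ) : ZMod p).val = 2 := ZMod.val_natCast_of_lt (by omega)
  have h3 : (((2 : ℕ) : ZMod p) + 1).val = 3 := by
    have := ZMod.val_natCast_of_lt (show 3 < p by omega)
    rw [← this]
    norm_num
  have h4 : ((0 : ZMod p) + 1).val = 1 := by
    have : Fact (1 < p) := ⟨by omega⟩
    rw [zero_add, ZMod.val_one]
  have hr0 : rotation p N s 0 = 1 := by simp [rotation, h0]
  -- Positions `0, 1, 2, 3` have offsets `0, 1, 2, 2 + s 1`, so the step `d = s 1` is found at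
  -- position `2`.
  refine ⟨h.isRotation.isEquivelarMap h.three_le ⟨0, hr0⟩,
    h.isRotation.isQuantumCodeOfDistance h.three_le h.rotation_add_add_ne (k₀ := 0)
      (k₁ := ((2 : ℕ) : ZMod p)) (d := s 1) ?_ h1 hr0 ?_ ?_ ?_ ?_ ?_⟩
  · have := h.growth 0 1 one_pos (by omega)
    omega
  · rw [rotation, h2]; simp
  · simp [offset]
  · rw [offset, h4]; simp [h0]
  · rw [offset, h2]; simp [h0, Finset.sum_range_succ]
  · rw [offset, h3]; simp [h0, Finset.sum_range_succ]

end IsStepSequence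

/-! ### The differences of `duttaSeq` and the step lengths of the two families. -/

/-- The sequence has differences `1, 1, 3, 3, 9, 9, …`, which makes its terms the partial sums of
doubled powers of three. -/
theorem duttaSeq_add_two (n : ℕ) : duttaSeq (n + 2) = duttaSeq (n + 1) + 3 ^ (n / 2) := by
  rcases Nat.even_or_odd' n with ⟨k, rfl | rfl⟩
  · have e1 : (2 * k + 2) / 2 - 1 = k := by omega
    have e2 : ¬ Odd (2 * k + 2) := by rw [Nat.odd_iff]; omega
    have e3 : Odd (2 * k + 1) := by rw [Nat.odd_iff]; omega
    have := Nat.one_le_pow k 3 (by norm_num)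
    simp only [duttaSeq, e1, e2, e3, if_true, if_false, Nat.add_sub_cancel,
      Nat.mul_div_cancel_left k two_pos]
    omega
  · have e1 : (2 * k + 1 + 1) / 2 - 1 = k := by omega
    have e2 : Odd (2 * k + 1 + 2) := by rw [Nat.odd_iff]; omega
    have e3 : ¬ Odd (2 * k + 1 + 1) := by rw [Nat.odd_iff]; omega
    have e4 : (2 * k + 1 + 2 - 1) / 2 = k + 1 := by omega
    have e5 : (2 * k + 1) / 2 = k := by omega
    have := Nat.one_le_pow k 3 (by norm_num)
    simp only [duttaSeq, e1, e2, e3, e4, e5, if_true, if_false, pow_succ]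
    omega

theorem sum_eq_duttaSeq {s : ℕ → ℕ} (n : ℕ) (hs : ∀ i, i < n → s (i / 2) = 3 ^ (i / 2)) :
    ∑ i ∈ Finset.range n, s (i / 2) = duttaSeq (n + 1) := by
  induction n with
  | zero => simp [duttaSeq]
  | succ n ih =>
    rw [Finset.sum_range_succ, ih fun i hi => hs i (by omega), hs n (by omega),
      ← duttaSeq_add_two]

theorem duttaSeq_two_mul_add_one (n : ℕ) : duttaSeq (2 * n + 1) = 3 ^ n - 1 := by
  have : Odd (2 * n + 1) := by rw [Nat.odd_iff]; omega
  simp [duttaSeq, this]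

theorem three_pow_growth {i j : ℕ} (hij : i < j) : 3 * 3 ^ i ≤ 3 ^ j := by
  rw [← pow_succ']
  exact Nat.pow_le_pow_right (by norm_num) hij

/-- The steps along the faces of `duttaEven`. -/
def evenStep (m₁ m₂ i : ℕ) : ℕ := if i = m₁ - 1 then 3 ^ i + m₂ else 3 ^ i

/-- The steps along the faces of `duttaOdd`. -/
def oddStep (m₁ m₂ i : ℕ) : ℕ :=
  if i = m₁ - 1 then 3 ^ i + 2 * m₂ - 1 else if i = m₁ - 2 then 3 ^ i + m₂ else 3 ^ i

theorem evenStep_of_lt {m₁ i : ℕ} (m₂ : ℕ) (hi : i + 1 < m₁) : evenStep m₁ m₂ i = 3 ^ i := by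
  rw [evenStep, if_neg (by omega)]

theorem oddStep_of_lt {m₁ i : ℕ} (m₂ : ℕ) (hi : i + 2 < m₁) : oddStep m₁ m₂ i = 3 ^ i := by
  rw [oddStep, if_neg (by omega), if_neg (by omega)]

theorem evenStep_sum {m₁ : ℕ} (m₂ : ℕ) {n : ℕ} (hn : n < 2 * m₁ - 1) :
    ∑ i ∈ Finset.range n, evenStep m₁ m₂ (i / 2) = duttaSeq (n + 1) :=
  sum_eq_duttaSeq n fun i hi => evenStep_of_lt m₂ (by omega)

theorem oddStep_sum {m₁ : ℕ} (m₂ : ℕ) {n : ℕ} (hn : n < 2 * m₁ - 3) :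
    ∑ i ∈ Finset.range n, oddStep m₁ m₂ (i / 2) = duttaSeq (n + 1) :=
  sum_eq_duttaSeq n fun i hi => oddStep_of_lt m₂ (by omega)

theorem evenStep_sum_pred {m₁ : ℕ} (m₂ : ℕ) (hm : 3 ≤ m₁) :
    ∑ i ∈ Finset.range (2 * m₁ - 1), evenStep m₁ m₂ (i / 2) = duttaSeq (2 * m₁) + m₂ := by
  obtain ⟨m, rfl⟩ : ∃ m, m₁ = m + 1 := ⟨m₁ - 1, by omega⟩
  have e : 2 * (m + 1) - 1 = 2 * m + 1 := by omega
  have e1 : 2 * m / 2 = m := by omega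
  rw [e, Finset.sum_range_succ, evenStep_sum m₂ (by omega), e1,
    show 2 * (m + 1) = 2 * m + 2 by ring, duttaSeq_add_two, e1, evenStep, if_pos (by omega)]
  ring

theorem oddStep_sum_pred_pred {m₁ : ℕ} (m₂ : ℕ) (hm : 3 ≤ m₁) :
    ∑ i ∈ Finset.range (2 * m₁ - 3), oddStep m₁ m₂ (i / 2) = duttaSeq (2 * m₁ - 2) + m₂ := by
  obtain ⟨m, rfl⟩ : ∃ m, m₁ = m + 2 := ⟨m₁ - 2, by omega⟩
  have e : 2 * (m + 2) - 3 = 2 * m + 1 := by omega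
  have e1 : 2 * m / 2 = m := by omega
  rw [e, Finset.sum_range_succ, oddStep_sum m₂ (by omega), e1,
    show 2 * (m + 2) - 2 = 2 * m + 2 by omega, duttaSeq_add_two, e1, oddStep,
    if_neg (by omega), if_pos (by omega)]
  ring

theorem oddStep_sum_pred {m₁ : ℕ} (m₂ : ℕ) (hm : 3 ≤ m₁) :
    ∑ i ∈ Finset.range (2 * m₁ - 2), oddStep m₁ m₂ (i / 2) =
      duttaSeq (2 * m₁ - 1) + 2 * m₂ := by
  have h := oddStep_sum_pred_pred m₂ hm
  obtain ⟨m, rfl⟩ : ∃ m, m₁ = m + 2 := ⟨m₁ - 2, by omega⟩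
  have e : 2 * (m + 2) - 2 = (2 * m + 1) + 1 := by omega
  have e' : 2 * (m + 2) - 3 = 2 * m + 1 := by omega
  have e1 : (2 * m + 1) / 2 = m := by omega
  rw [e'] at h
  rw [e, Finset.sum_range_succ, h, e1,
    show 2 * (m + 2) - 1 = (2 * m + 1) + 2 by omega, duttaSeq_add_two, e1, oddStep,
    if_neg (by omega), if_pos (by omega), e]
  ring

/-! ### Verification of the step conditions. -/

theorem isStepSequence_even {m₁ : ℕ} (m₂ : ℕ) (hm : 3 ≤ m₁) :
    IsStepSequence (2 * m₁) (evenOrder m₁ m₂) (evenStep m₁ m₂) := by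
  have hsum := evenStep_sum_pred m₂ hm
  obtain ⟨m, rfl⟩ : ∃ m, m₁ = m + 1 := ⟨m₁ - 1, by omega⟩
  have hlast : evenStep (m + 1) m₂ m = 3 ^ m + m₂ := by simp [evenStep]
  have hN : evenOrder (m + 1) m₂ = 3 * 3 ^ m + 2 * m₂ - 1 := by rw [evenOrder, pow_succ']
  have hlt : ∀ i, i < m → evenStep (m + 1) m₂ i = 3 ^ i ∧ 3 * 3 ^ i ≤ 3 ^ m := fun i hi =>
    ⟨evenStep_of_lt m₂ (by omega), three_pow_growth hi⟩
  have h3 : 3 * 3 ^ 1 ≤ 3 ^ m := three_pow_growth (by omega)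
  have hcase : ∀ i, 2 * i < 2 * (m + 1) → i < m ∨ i = m := fun i hi => by omega
  refine ⟨by omega, fun i hi => ?_, fun i j hij hj => ?_, ?_, fun i hi => ?_,
    fun i hi => by omega, fun i j k hi hj hk => ?_⟩
  · have := Nat.pow_pos (n := i) (show 0 < 3 by norm_num)
    rcases hcase i hi with h | rfl
    · rw [(hlt i h).1]; exact this
    · omega
  · have := three_pow_growth hij
    have := Nat.pow_pos (n := i) (show 0 < 3 by norm_num)
    rw [(hlt i (by omega)).1]
    rcases hcase j hj with h | rfl
    · rw [(hlt j h).1]; omega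
    · omega
  · have e : 2 * (m + 1) - 1 = 2 * m + 1 := by omega
    have e1 : (2 * m + 1) / 2 = m := by omega
    have e2 := duttaSeq_two_mul_add_one (m + 1)
    rw [show 2 * (m + 1) + 1 = (2 * m + 1) + 2 by ring, duttaSeq_add_two, e1, pow_succ'] at e2
    rw [e] at hsum
    rw [show 2 * (m + 1) = (2 * m + 1) + 1 by ring, Finset.sum_range_succ, hsum, e1, hlast, hN,
      show 2 * (m + 1) = 2 * m + 1 + 1 by ring]
    omega
  · rcases hcase i (by omega) with h | rfl
    · have := hlt i h
      omega
    · omega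
  -- Three copies of the last step exceed `N`. With at most two copies the sum stays below `N`, as
  -- every other step is at most `3 ^ m / 3`.
  · rcases hcase i hi with h1 | rfl <;> rcases hcase j hj with h2 | rfl <;>
      rcases hcase k hk with h3 | rfl
    · have := hlt i h1; have := hlt j h2; have := hlt k h3; omega
    · have := hlt i h1; have := hlt j h2; omega
    · have := hlt i h1; have := hlt k h3; omega
    · have := hlt i h1; omega
    · have := hlt j h2; have := hlt k h3; omega
    · have := hlt j h2; omega
    · have := hlt k h3; omega
    · omega

theorem isStepSequence_odd {m₁ : ℕ} (m₂ : ℕ) (hm : 3 ≤ m₁) :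
    IsStepSequence (2 * m₁ - 1) (oddOrder m₁ m₂) (oddStep m₁ m₂) := by
  have hsum := oddStep_sum_pred m₂ hm
  obtain ⟨m, rfl⟩ : ∃ m, m₁ = m + 2 := ⟨m₁ - 2, by omega⟩
  have hlast : oddStep (m + 2) m₂ (m + 1) = 3 * 3 ^ m + 2 * m₂ - 1 := by
    simp [oddStep, pow_succ']
  have hprev : oddStep (m + 2) m₂ m = 3 ^ m + m₂ := by simp [oddStep]
  have hN : oddOrder (m + 2) m₂ = 2 * (3 * 3 ^ m + 2 * m₂ - 1) := by
    rw [oddOrder, show m + 2 - 1 = m + 1 by omega, pow_succ']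
  have hlt : ∀ i, i < m → oddStep (m + 2) m₂ i = 3 ^ i ∧ 3 * 3 ^ i ≤ 3 ^ m := fun i hi =>
    ⟨oddStep_of_lt m₂ (by omega), three_pow_growth hi⟩
  have h3 : 3 * 3 ^ 0 ≤ 3 ^ m := three_pow_growth (by omega)
  have hcase : ∀ i, 2 * i < 2 * (m + 2) - 1 → i < m ∨ i = m ∨ i = m + 1 :=
    fun i hi => by omega
  have hpos : ∀ i, 2 * i < 2 * (m + 2) - 1 → 0 < oddStep (m + 2) m₂ i := by
    intro i hi
    have := Nat.pow_pos (n := i) (show 0 < 3 by norm_num)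
    rcases hcase i hi with h | rfl | rfl
    · rw [(hlt i h).1]; exact this
    · omega
    · omega
  -- Every step but the last is below `N / 4`.
  have hmid : ∀ i, i < m + 1 → 2 * oddStep (m + 2) m₂ i < 3 * 3 ^ m + 2 * m₂ - 1 := by
    intro i hi
    rcases hcase i (by omega) with h | rfl | rfl
    · have := hlt i h
      omega
    · omega
    · omega
  refine ⟨by omega, hpos, fun i j hij hj => ?_, ?_, fun i hi => ?_,
    fun i hi => ?_, fun i j k hi hj hk => ?_⟩
  · rcases hcase j hj with h | rfl | rfl
    · have := three_pow_growth hij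
      have := Nat.pow_pos (n := i) (show 0 < 3 by norm_num)
      rw [(hlt i (by omega)).1, (hlt j h).1]; omega
    · have := hlt i hij
      have := Nat.pow_pos (n := i) (show 0 < 3 by norm_num)
      omega
    · rw [hlast]
      exact hmid i hij
  · have e : 2 * (m + 2) - 1 = (2 * (m + 2) - 2) + 1 := by omega
    have e1 : (2 * (m + 2) - 2) / 2 = m + 1 := by omega
    have e2 := duttaSeq_two_mul_add_one (m + 1)
    rw [pow_succ'] at e2
    rw [e, Finset.sum_range_succ, hsum, e1, hlast, hN,
      show 2 * (m + 2) - 1 = 2 * (m + 1) + 1 by omega]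
    omega
  · have := hmid i (by omega)
    omega
  · obtain rfl : i = m + 1 := by omega
    omega
  -- The last step is `N / 2`: two copies plus a positive term exceed `N`, while with at most one
  -- copy the sum is below `N`.
  · have hi0 := hpos i hi
    have hj0 := hpos j hj
    have hk0 := hpos k hk
    have hc : ∀ i, 2 * i < 2 * (m + 2) - 1 → i < m + 1 ∨ i = m + 1 := fun i hi => by omega
    rcases hc i hi with h1 | rfl <;> rcases hc j hj with h2 | rfl <;>
      rcases hc k hk with h3 | rfl
    · have := hmid i h1; have := hmid j h2; have := hmid k h3; omega
    · have := hmid i h1; have := hmid j h2; omega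
    · have := hmid i h1; have := hmid k h3; omega
    · omega
    · have := hmid j h2; have := hmid k h3; omega
    · omega
    · omega
    · omega

/-! ### Identification with the given polygons, and conclusion. -/

theorem duttaEven_eq (m₁ m₂ : ℕ) (hm : 3 ≤ m₁) : duttaEven m₁ m₂ =
    circulantSystem (IsStepSequence.offset (2 * m₁) (evenOrder m₁ m₂) (evenStep m₁ m₂)) := by
  have : NeZero (2 * m₁) := ⟨by omega⟩
  rw [duttaEven, circulantSystem, PolygonSystem.mk.injEq]
  funext j k
  have hk := k.val_lt
  rw [add_assoc, IsStepSequence.offset]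
  congr 1
  split_ifs with h
  · rw [h, show k.val = 2 * m₁ - 1 by omega, evenStep_sum_pred m₂ hm]
    push_cast
    rfl
  · rw [evenStep_sum m₂ (by omega), add_zero]

theorem duttaOdd_eq (m₁ m₂ : ℕ) (hm : 3 ≤ m₁) : duttaOdd m₁ m₂ =
    circulantSystem (IsStepSequence.offset (2 * m₁ - 1) (oddOrder m₁ m₂)
      (oddStep m₁ m₂)) := by
  have : NeZero (2 * m₁ - 1) := ⟨by omega⟩
  rw [duttaOdd, circulantSystem, PolygonSystem.mk.injEq]
  funext j k
  have hk := k.val_lt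
  rw [add_assoc, IsStepSequence.offset]
  congr 1
  split_ifs with h h'
  · rw [h, show k.val = 2 * m₁ - 2 by omega, oddStep_sum_pred m₂ hm]
    push_cast
    rfl
  · rw [h', show k.val = 2 * m₁ - 3 by omega, oddStep_sum_pred_pred m₂ hm]
    push_cast
    rfl
  · rw [oddStep_sum m₂ (by omega), add_zero]

theorem mainTheorem3 (m₁ m₂ : ℕ) [Fact (3 ≤ m₁)] :
    ((duttaOdd m₁ m₂).IsEquivelarMap (2 * m₁ - 1) ∧
      IsQuantumCodeOfDistance (duttaOdd m₁ m₂).HX (duttaOdd m₁ m₂).HZ 4) ∧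
    ((duttaEven m₁ m₂).IsEquivelarMap (2 * m₁) ∧
      IsQuantumCodeOfDistance (duttaEven m₁ m₂).HX (duttaEven m₁ m₂).HZ 4) := by
  have hm : 3 ≤ m₁ := Fact.out
  have : NeZero (2 * m₁) := ⟨by omega⟩
  have : NeZero (2 * m₁ - 1) := ⟨by omega⟩
  constructor
  · rw [duttaOdd_eq m₁ m₂ hm]
    refine (isStepSequence_odd m₂ hm).equivelar_and_distance (by omega) ?_ ?_
    · rw [oddStep_of_lt m₂ (by omega), pow_zero]
    -- For `m₁ = 3` the step `s 1` already carries the correction and equals `3 + m₂`; for larger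
    -- `m₁` it is `3`.
    · rcases hm.eq_or_lt with rfl | h
      · simp only [oddStep, oddOrder]
        norm_num
        omega
      · have h3 : 3 * 3 ^ 2 ≤ 3 ^ (m₁ - 1) := three_pow_growth (by omega)
        rw [oddStep_of_lt m₂ (by omega), oddOrder]
        omega
  · rw [duttaEven_eq m₁ m₂ hm]
    refine (isStepSequence_even m₂ hm).equivelar_and_distance (by omega) ?_ ?_
    · rw [evenStep_of_lt m₂ (by omega), pow_zero]
    · have h3 : 3 * 3 ^ 2 ≤ 3 ^ m₁ := three_pow_growth (by omega)
      rw [evenStep_of_lt m₂ (by omega), evenOrder]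
      omega
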